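/- For a normal space $X$, the large inductive dimension $\operatorname{Ind}(X)\in\{-1,0,1,\dots\}\cup\{\infty\}$ is defined by: $\operatorname{Ind}(X)=-1$ iff $X=\emptyset$; for $n\ge 0$, $\operatorname{Ind}(X)\le n$ iff for every closed $A\subseteq X$ and every open $V\supseteq A$ there is an open $U$ with $A\subseteq U\subseteq V$ and $\operatorname{Ind}(\partial U)\le n-1$; $\operatorname{Ind}(X)$ is the least $n\geq -1$ with $\operatorname{Ind}(X)\le n$, and $\infty$ if there is none. Every ordinal $\beta$ is uniquely $\beta=\lambda(\beta)+n(\beta)$, where $\lambda(\beta)$ is the largest ordinal $\le\beta$ that is $0$ or a limit ordinal, and $n(\beta)<\omega_0$. For a metrizable space $X$, put $D(X)=-1$ if $X=\emptyset$. Otherwise $D(X)$ is the smallest ordinal $\beta$ for which there are sets $A_\alpha\subseteq X$ $(0\le\alpha\le\lambda(\beta))$ with $X=\bigcup\{A_\alpha:0\le\alpha\le\lambda(\beta)\}$ such that (i) each $A_\alpha$ is closed in $X$ and $\operatorname{Ind}(A_\alpha)<\infty$; (ii) for each $\delta$, the set $\bigcup\{A_\alpha:\delta\le\alpha\le\lambda(\beta)\}$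 is closed in $X$; (iii) $n(\beta)=\operatorname{Ind}(A_{\lambda(\beta)})$ if $A_{\lambda(\beta)}\ne\emptyset$, and $n(\beta)=0$ if $A_{\lambda(\beta)}=\emptyset$; (iv) for each $x\in X$ there is a largest $\delta\le\lambda(\beta)$ with $x\in A_\delta$. If there is no such $\beta$, then $D(X)$ is the symbol $\Omega$. **Theorem.** Let $X$ be a metrizable space with $X=X_*\cup X_0$, where $X_*$ is a nonempty closed subset of $X$ and $X_0$ is countable (possibly finite or empty). Then $D(X)=D(X_*)$, where $X_*$ carries the subspace topology. -/

import Mathlib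

open Set
open scoped Ordinal

universe u

noncomputable section

namespace DDim

/-- `LargeIndLT n X` says that the large inductive dimension of `X` is less than `n`, that is
`Ind X ≤ n - 1`. So `Ind X ≤ -1` means that `X` is empty, and `Ind X ≤ n` means that every closed
`A` inside an open `V` has an open `U` with `A ⊆ U ⊆ V` and `Ind (∂U) ≤ n - 1`. -/
def LargeIndLT : ℕ → ∀ (X : Type u) [TopologicalSpace X], Prop
  | 0, X, _ => IsEmpty X
  | n + 1, X, _ => ∀ A V : Set X, IsClosed A → IsOpen V → A ⊆ V →
      ∃ U : Set X, IsOpen U ∧ A ⊆ U ∧ U ⊆ V ∧ LargeIndLT n (frontier U)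

open Classical in
/-- The large inductive dimension `Ind X`, with `⊥` for `-1` and `⊤` for `∞`: the least `n` with
`Ind X ≤ n`. -/
def largeInd (X : Type u) [TopologicalSpace X] : WithBot ℕ∞ :=
  if IsEmpty X then ⊥
  else ((⨅ n : {n : ℕ // LargeIndLT (n + 1) X}, ((n : ℕ) : ℕ∞) : ℕ∞) : WithBot ℕ∞)

/-- `λ(β)`: the largest ordinal `≤ β` that is zero or a limit (see `isGreatest_limitPart`). -/
def limitPart (β : Ordinal.{u}) : Ordinal.{u} := ω * (β / ω)

/-- `n(β)`: the natural number with `β = λ(β) + n(β)` (see `limitPart_add_finitePart`). -/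
def finitePart (β : Ordinal.{u}) : ℕ := Cardinal.toNat (β % ω).card

theorem limitPart_add_finitePart (β : Ordinal.{u}) :
    limitPart β + (finitePart β : Ordinal.{u}) = β := by
  obtain ⟨n, hn⟩ := Ordinal.lt_omega0.1 (Ordinal.mod_lt β Ordinal.omega0_ne_zero)
  have h : (finitePart β : Ordinal.{u}) = β % ω := by
    simp [finitePart, hn]
  rw [h, limitPart, Ordinal.div_add_mod]

theorem isGreatest_limitPart (β : Ordinal.{u}) :
    IsGreatest {l : Ordinal.{u} | l ≤ β ∧ (l = 0 ∨ Order.IsSuccLimit l)} (limitPart β) := by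
  constructor
  · refine ⟨Ordinal.mul_div_le β ω, ?_⟩
    by_cases h : β / ω = 0
    · left; simp [limitPart, h]
    · right
      exact Ordinal.isSuccLimit_mul_left Ordinal.isSuccLimit_omega0 (pos_iff_ne_zero.2 h)
  · rintro l ⟨hl, hl'⟩
    have hd : ω ∣ l := by
      rcases hl' with rfl | hl'
      · exact dvd_zero _
      · exact (Ordinal.isSuccPrelimit_iff_omega0_dvd.1 hl'.isSuccPrelimit)
    obtain ⟨c, rfl⟩ := hd
    exact mul_le_mul_right ((Ordinal.mul_le_iff_le_div Ordinal.omega0_ne_zero).1 hl) _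

/-- `X = ⋃ {A α : 0 ≤ α ≤ λ(β)}` is a `β`-`D` representation of `X`. Only the values `A α` with
`α ≤ λ(β)` matter. -/
structure IsDRepresentation (X : Type u) [TopologicalSpace X] (β : Ordinal.{u})
    (A : Ordinal.{u} → Set X) : Prop where
  iUnion_eq : ⋃ α ∈ Iic (limitPart β), A α = univ
  isClosed : ∀ α ≤ limitPart β, IsClosed (A α)
  finiteDimensional : ∀ α ≤ limitPart β, largeInd (A α) < ⊤
  isClosed_tail : ∀ δ, IsClosed (⋃ α ∈ Icc δ (limitPart β), A α)
  finitePart_eq : (A (limitPart β)).Nonempty →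
    largeInd (A (limitPart β)) = ((finitePart β : ℕ∞) : WithBot ℕ∞)
  finitePart_eq_zero : A (limitPart β) = ∅ → finitePart β = 0
  exists_greatest : ∀ x, ∃ δ, IsGreatest {α | α ≤ limitPart β ∧ x ∈ A α} δ

open Classical in
/-- The `D`-dimension of `X`: `⊥` stands for `-1`, the value of the empty space, and `⊤` for `Ω`,
the value when there is no `D` representation. -/
def dDim (X : Type u) [TopologicalSpace X] : WithBot (WithTop Ordinal.{u}) :=
  if IsEmpty X then ⊥
  else if ∃ β, ∃ A, IsDRepresentation X β A then
    ((sInf {β : Ordinal.{u} | ∃ A, IsDRepresentation X β A} : Ordinal.{u}) : WithTop Ordinal.{u})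
  else ((⊤ : WithTop Ordinal.{u}) : WithBot (WithTop Ordinal.{u}))

end DDim

end

open Topology

namespace DDim

/-! Write `F` for the closed subspace. A metrizable space retracts onto any nonempty closed `F` with
countable complement. Pulling a representation of `F` back along the retraction only adds countably
many points to each member. This leaves `Ind` unchanged, since a separating level can be chosen
among uncountably many to avoid them. The other conditions pass to preimages, so `D(X) ≤ D(F)`.
Conversely, a representation of `X` restricts to `F`, and only its finite part can drop. -/

theorem LargeIndLT.succ {n : ℕ} {X : Type u} [TopologicalSpace X] (h : LargeIndLT n X) :
    LargeIndLT (n + 1) X := by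
  induction n generalizing X with
  | zero =>
    intro A V _ _ _
    have : IsEmpty X := h
    exact ⟨∅, isOpen_empty, fun x => isEmptyElim x, fun x => isEmptyElim x,
      ⟨fun x => isEmptyElim x.1⟩⟩
  | succ n ih =>
    intro A V hA hV hAV
    obtain ⟨U, hU, hAU, hUV, hfr⟩ := h A V hA hV hAV
    exact ⟨U, hU, hAU, hUV, ih hfr⟩

theorem LargeIndLT.mono {m n : ℕ} (hmn : m ≤ n) {X : Type u} [TopologicalSpace X]
    (h : LargeIndLT m X) : LargeIndLT n X := by
  induction hmn with
  | refl => exact h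
  | step _ ih => exact ih.succ

theorem LargeIndLT.of_isEmpty (n : ℕ) {X : Type u} [TopologicalSpace X] [h : IsEmpty X] :
    LargeIndLT n X :=
  LargeIndLT.mono (Nat.zero_le n) (m := 0) h

theorem LargeIndLT.of_isClosedEmbedding {n : ℕ} {X Y : Type u} [TopologicalSpace X]
    [TopologicalSpace Y] {f : Y → X} (hf : IsClosedEmbedding f) (h : LargeIndLT n X) :
    LargeIndLT n Y := by
  induction n generalizing X Y with
  | zero => exact ⟨fun y => IsEmpty.false (self := h) (f y)⟩
  | succ n ih =>
    intro A V hA hV hAV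
    obtain ⟨V', hV', rfl⟩ := hf.isInducing.isOpen_iff.1 hV
    obtain ⟨U, hU, hAU, hUV, hfr⟩ := h (f '' A) V' (hf.isClosedMap A hA) hV' (image_subset_iff.2 hAV)
    have hsub : frontier (f ⁻¹' U) ⊆ f ⁻¹' frontier U := hf.continuous.frontier_preimage_subset U
    refine ⟨f ⁻¹' U, hU.preimage hf.continuous, image_subset_iff.1 hAU, preimage_mono hUV, ?_⟩
    let g : frontier (f ⁻¹' U) → frontier U := fun y => ⟨f y.1, hsub y.2⟩
    have hfg : IsClosedEmbedding (Subtype.val ∘ g) :=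
      hf.comp isClosed_frontier.isClosedEmbedding_subtypeVal
    exact ih (f := g) (hfg.of_comp IsEmbedding.subtypeVal) hfr

theorem LargeIndLT.subset {n : ℕ} {X : Type u} [TopologicalSpace X] {s t : Set X}
    (hs : IsClosed s) (hst : s ⊆ t) (h : LargeIndLT n t) : LargeIndLT n s :=
  h.of_isClosedEmbedding (f := inclusion hst)
    ⟨IsEmbedding.inclusion hst, by
      rw [range_inclusion]; exact hs.preimage continuous_subtype_val⟩

/-! ### Countably many extra points and large inductive dimension -/

/-- The quotient `d(x,P) / (d(x,P) + d(x,Q))` takes only countably many values on `C`, so some `t`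
in `(0,1)` is missed. Only points at distance zero from both sets can still satisfy the equation. -/
theorem exists_separating_level_avoiding_countable {X : Type*} [MetricSpace X] {P Q C : Set X}
    (hC : C.Countable) :
    ∃ t : ℝ, 0 < t ∧ t < 1 ∧ ∀ x ∈ C, (1 - t) * Metric.infDist x P = t * Metric.infDist x Q →
      Metric.infDist x P = 0 ∧ Metric.infDist x Q = 0 := by
  obtain ⟨t, ht, htC⟩ : ∃ t ∈ Ioo (0 : ℝ) 1,
      t ∉ (fun x => Metric.infDist x P / (Metric.infDist x P + Metric.infDist x Q)) '' C := by
    by_contra! h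
    exact (Cardinal.Real.Ioo_countable_iff.not.2 (by norm_num)) ((hC.image _).mono h)
  refine ⟨t, ht.1, ht.2, fun x hx h => ?_⟩
  have hP := Metric.infDist_nonneg (x := x) (s := P)
  have hQ := Metric.infDist_nonneg (x := x) (s := Q)
  by_cases h0 : Metric.infDist x P + Metric.infDist x Q = 0
  · constructor <;> linarith
  · refine absurd ⟨x, hx, ?_⟩ htC
    simp only
    rw [div_eq_iff h0]
    linarith

/-- Adding countably many points to a nonnegative-dimensional closed subspace of a metrizable space
does not raise the large inductive dimension. -/
theorem LargeIndLT.of_countable_compl_range {n : ℕ} {X Y : Type u} [TopologicalSpace X]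
    [TopologicalSpace.MetrizableSpace X] [TopologicalSpace Y] {f : Y → X}
    (hf : IsClosedEmbedding f) (hc : (range f)ᶜ.Countable) (h : LargeIndLT (n + 1) Y) :
    LargeIndLT (n + 1) X := by
  let _ := TopologicalSpace.metrizableSpaceMetric X
  intro A V hA hV hAV
  -- `infDist` to the empty set is `0`, so the distance argument needs both `A` and `Vᶜ` nonempty.
  rcases A.eq_empty_or_nonempty with rfl | hAne
  · refine ⟨∅, isOpen_empty, Subset.rfl, empty_subset _, ?_⟩
    rw [frontier_empty]
    exact .of_isEmpty n
  rcases Vᶜ.eq_empty_or_nonempty with hVe | hVne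
  · refine ⟨univ, isOpen_univ, subset_univ _, (compl_empty_iff.1 hVe).ge, ?_⟩
    rw [frontier_univ]
    exact .of_isEmpty n
  obtain ⟨U, hU, hAU, hUV, hfr⟩ := h (f ⁻¹' A) (f ⁻¹' V) (hA.preimage hf.continuous)
    (hV.preimage hf.continuous) (preimage_mono hAV)
  -- The separating open set will be the points relatively closer to `P` than to `Q`. Adding the
  -- images of `U` and of its exterior forces the boundary to meet `range f` only in the image of
  -- `frontier U`.
  let P : Set X := A ∪ f '' U
  let Q : Set X := Vᶜ ∪ f '' (closure U)ᶜ
  have hclP : closure P = A ∪ f '' closure U := by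
    rw [closure_union, hA.closure_eq, hf.closure_image_eq]
  have hclQ : closure Q = Vᶜ ∪ f '' closure (closure U)ᶜ := by
    rw [closure_union, hV.isClosed_compl.closure_eq, hf.closure_image_eq]
  have hdisj : ∀ y ∈ U, y ∉ closure (closure U)ᶜ := fun y hy hy' => by
    rw [closure_compl] at hy'
    exact hy' (interior_maximal subset_closure hU hy)
  have hPmem : ∀ x, Metric.infDist x P = 0 ↔ x ∈ A ∪ f '' closure U := fun x => by
    rw [← hclP, Metric.mem_closure_iff_infDist_zero (hAne.mono subset_union_left)]
  have hQmem : ∀ x, Metric.infDist x Q = 0 ↔ x ∈ Vᶜ ∪ f '' closure (closure U)ᶜ := fun x => by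
    rw [← hclQ, Metric.mem_closure_iff_infDist_zero (hVne.mono subset_union_left)]
  have hUQ : ∀ y ∈ U, Metric.infDist (f y) Q ≠ 0 := fun y hy h0 => by
    rcases (hQmem _).1 h0 with h0 | ⟨z, hz, hzy⟩
    · exact h0 (hUV hy)
    · exact hdisj y hy (hf.injective hzy ▸ hz)
  obtain ⟨t, ht0, ht1, ht⟩ :=
    exists_separating_level_avoiding_countable (P := P) (Q := Q) hc
  have hcP : Continuous fun x => (1 - t) * Metric.infDist x P :=
    continuous_const.mul (Metric.continuous_infDist_pt P)
  have hcQ : Continuous fun x => t * Metric.infDist x Q :=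
    continuous_const.mul (Metric.continuous_infDist_pt Q)
  refine ⟨{x | (1 - t) * Metric.infDist x P < t * Metric.infDist x Q}, isOpen_lt hcP hcQ,
    fun x hx => ?_, fun x hx => ?_, ?_⟩
  · have hx0 : Metric.infDist x P = 0 := (hPmem x).2 (Or.inl hx)
    have hx1 : Metric.infDist x Q ≠ 0 := fun h0 => by
      rcases (hQmem _).1 h0 with h1 | ⟨z, hz, rfl⟩
      · exact h1 (hAV hx)
      · exact hUQ z (hAU hx) h0
    have := lt_of_le_of_ne Metric.infDist_nonneg hx1.symm
    simp only [mem_ofPred_eq, hx0, mul_zero]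
    positivity
  · by_contra hxV
    have hx0 : Metric.infDist x Q = 0 := (hQmem x).2 (Or.inl hxV)
    simp only [mem_ofPred_eq, hx0, mul_zero] at hx
    exact hx.not_ge (mul_nonneg (by linarith) Metric.infDist_nonneg)
  · refine LargeIndLT.subset (t := f '' frontier U) isClosed_frontier
      ((frontier_lt_subset_eq hcP hcQ).trans fun x hx => ?_)
      (hfr.of_isClosedEmbedding
        (hf.isEmbedding.homeomorphImage (frontier U)).symm.isClosedEmbedding)
    have hx : (1 - t) * Metric.infDist x P = t * Metric.infDist x Q := hx
    by_cases hxr : x ∈ range f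
    · obtain ⟨y, rfl⟩ := hxr
      refine ⟨y, ?_, rfl⟩
      rw [hU.frontier_eq]
      refine ⟨?_, fun hy => ?_⟩
      · by_contra hy
        have h0 : Metric.infDist (f y) Q = 0 := (hQmem _).2 (Or.inr ⟨y, subset_closure hy, rfl⟩)
        rw [h0, mul_zero, mul_eq_zero, hPmem] at hx
        rcases hx with hx | hx | ⟨z, hz, hzy⟩
        · linarith
        · exact hy (subset_closure (hAU hx))
        · exact hy (hf.injective hzy ▸ hz)
      · have h0 : Metric.infDist (f y) P = 0 :=
          (hPmem _).2 (Or.inr ⟨y, subset_closure hy, rfl⟩)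
        rw [h0, mul_zero, eq_comm, mul_eq_zero] at hx
        exact hx.elim ht0.ne' (hUQ y hy)
    -- By the choice of `t`, a boundary point outside `range f` lies in both closures, hence in `A ∩
    -- Vᶜ = ∅`.
    · obtain ⟨h1, h2⟩ := ht x hxr hx
      rcases (hPmem x).1 h1 with h1 | ⟨z, -, rfl⟩
      · rcases (hQmem x).1 h2 with h2 | ⟨z, -, rfl⟩
        · exact absurd (hAV h1) h2
        · exact absurd (mem_range_self z) hxr
      · exact absurd (mem_range_self z) hxr

theorem largeInd_of_isEmpty (X : Type u) [TopologicalSpace X] [h : IsEmpty X] : largeInd X = ⊥ :=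
  if_pos h

theorem largeInd_le_iff {X : Type u} [TopologicalSpace X] {n : ℕ} :
    largeInd X ≤ ((n : ℕ∞) : WithBot ℕ∞) ↔ LargeIndLT (n + 1) X := by
  by_cases hX : IsEmpty X
  · simp [largeInd_of_isEmpty, LargeIndLT.of_isEmpty]
  rw [largeInd, if_neg hX, WithBot.coe_le_coe]
  constructor
  · intro h
    by_contra hn
    refine (lt_of_lt_of_le (b := ((n + 1 : ℕ) : ℕ∞)) (by exact_mod_cast n.lt_succ_self) ?_).not_ge h
    refine le_iInf fun ⟨m, hm⟩ => ?_
    by_contra! hmn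
    have hmn : m < n + 1 := Nat.cast_lt.1 hmn
    exact hn (hm.mono (by omega))
  · exact fun h => iInf_le (fun m : {n : ℕ // LargeIndLT (n + 1) X} => ((m : ℕ) : ℕ∞)) ⟨n, h⟩

theorem exists_largeInd_eq_natCast {X : Type u} [TopologicalSpace X] [Nonempty X]
    (h : largeInd X < ⊤) : ∃ n : ℕ, largeInd X = ((n : ℕ∞) : WithBot ℕ∞) := by
  have hne : ¬ IsEmpty X := not_isEmpty_of_nonempty X
  rw [largeInd, if_neg hne] at h ⊢
  obtain ⟨n, hn⟩ := ENat.ne_top_iff_exists.1 (WithBot.coe_lt_coe.1 h).ne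
  exact ⟨n, by rw [hn]⟩

theorem largeInd_eq_of_forall_largeIndLT_iff {X Y : Type u} [TopologicalSpace X]
    [TopologicalSpace Y] (hXY : IsEmpty X ↔ IsEmpty Y)
    (h : ∀ n, LargeIndLT (n + 1) X ↔ LargeIndLT (n + 1) Y) : largeInd X = largeInd Y := by
  by_cases hX : IsEmpty X
  · rw [largeInd, largeInd, if_pos hX, if_pos (hXY.1 hX)]
  · rw [largeInd, largeInd, if_neg hX, if_neg (mt hXY.2 hX)]
    simp only [iInf_subtype, h]

theorem largeInd_le_of_isClosedEmbedding {X Y : Type u} [TopologicalSpace X] [TopologicalSpace Y]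
    {f : Y → X} (hf : IsClosedEmbedding f) (h : largeInd X < ⊤) : largeInd Y ≤ largeInd X := by
  by_cases hX : IsEmpty X
  · have : IsEmpty Y := ⟨fun y => hX.false (f y)⟩
    simp [largeInd_of_isEmpty]
  · have := not_isEmpty_iff.1 hX
    obtain ⟨n, hn⟩ := exists_largeInd_eq_natCast h
    rw [hn, largeInd_le_iff]
    exact (largeInd_le_iff.1 hn.le).of_isClosedEmbedding hf

/-- `hYX` excludes an empty `Y` in a nonempty countable `X`, where `Ind` would rise from `-1` to
`0`. -/
theorem largeInd_eq_of_countable_compl_range {X Y : Type u} [TopologicalSpace X]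
    [TopologicalSpace.MetrizableSpace X] [TopologicalSpace Y] {f : Y → X}
    (hf : IsClosedEmbedding f) (hc : (range f)ᶜ.Countable) (hYX : IsEmpty Y → IsEmpty X) :
    largeInd X = largeInd Y :=
  largeInd_eq_of_forall_largeIndLT_iff ⟨fun h => ⟨fun y => h.false (f y)⟩, hYX⟩ fun _ =>
    ⟨fun h => h.of_isClosedEmbedding hf, fun h => h.of_countable_compl_range hf hc⟩

/-! ### Retraction onto a closed set with countable complement -/

/-- Some small radius is not the distance from `x` to any of the countably many points off `F`, and
`F` itself is farther away, so the sphere is empty and the ball is clopen. -/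
theorem exists_isClopen_ball_subset {X : Type*} [MetricSpace X] {F : Set X}
    (hF : IsClosed F) (hne : F.Nonempty) (hc : Fᶜ.Countable) {x : X} (hx : x ∉ F) :
    ∃ K : Set X, IsClopen K ∧ x ∈ K ∧ ∀ y ∈ K, dist y x < Metric.infDist x F / 2 := by
  have hpos : 0 < Metric.infDist x F / 2 :=
    half_pos ((hF.notMem_iff_infDist_pos hne).1 hx)
  obtain ⟨r, hr, hrC⟩ : ∃ r ∈ Ioo 0 (Metric.infDist x F / 2), r ∉ (fun y => dist y x) '' Fᶜ := by
    by_contra! h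
    exact (Cardinal.Real.Ioo_countable_iff.not.2 hpos.not_ge) ((hc.image _).mono h)
  have heq : Metric.ball x r = Metric.closedBall x r := by
    refine Metric.ball_subset_closedBall.antisymm fun y hy => ?_
    refine lt_of_le_of_ne (Metric.mem_closedBall.1 hy) fun hyr => hrC ⟨y, fun hyF => ?_, hyr⟩
    have := Metric.infDist_le_dist_of_mem (x := x) hyF
    rw [dist_comm, hyr] at this
    linarith [hr.2]
  exact ⟨Metric.ball x r, ⟨heq ▸ Metric.isClosed_closedBall, Metric.isOpen_ball⟩,
    Metric.mem_ball_self hr.1, fun y hy => (Metric.mem_ball.1 hy).trans hr.2⟩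

theorem isOpen_find_eq {X : Type*} [TopologicalSpace X] {K : ℕ → Set X}
    (hK : ∀ n, IsClopen (K n)) (n : ℕ) : IsOpen {x | x ∈ K n ∧ ∀ m < n, x ∉ K m} := by
  have : {x | x ∈ K n ∧ ∀ m < n, x ∉ K m} = K n ∩ ⋂ m ∈ Iio n, (K m)ᶜ := by
    ext; simp
  rw [this]
  exact (hK n).isOpen.inter ((finite_Iio n).isOpen_biInter fun m _ => (hK m).compl.isOpen)

/-- A nonempty closed subset with countable complement is a retract. -/
theorem exists_retraction_of_countable_compl {X : Type*} [TopologicalSpace X]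
    [TopologicalSpace.MetrizableSpace X] {F : Set X} (hF : IsClosed F) (hne : F.Nonempty)
    (hc : Fᶜ.Countable) : ∃ p : X → F, Continuous p ∧ ∀ x : F, p x = x := by
  classical
  let _ := TopologicalSpace.metrizableSpaceMetric X
  rcases Fᶜ.eq_empty_or_nonempty with hFe | hCne
  · have hF' : ∀ x, x ∈ F := fun x => (compl_empty_iff.1 hFe).ge (mem_univ x)
    exact ⟨fun x => ⟨x, hF' x⟩, continuous_id.subtype_mk _, fun x => rfl⟩
  obtain ⟨c, hcr⟩ := hc.exists_eq_range hCne
  have hcF : ∀ k, c k ∉ F := fun k => hcr.ge (mem_range_self k)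
  choose K hK hcK hKd using fun k => exists_isClopen_ball_subset hF hne hc (hcF k)
  have hq : ∀ k, ∃ q ∈ F, dist (c k) q < 2 * Metric.infDist (c k) F := fun k => by
    rw [← Metric.infDist_lt_iff hne]
    linarith [(hF.notMem_iff_infDist_pos hne).1 (hcF k)]
  choose q hqF hqd using hq
  have hcov : ∀ x, x ∉ F → ∃ k, x ∈ K k := fun x hx => by
    obtain ⟨k, rfl⟩ : x ∈ range c := hcr.le hx
    exact ⟨k, hcK k⟩
  -- A point off `F` goes to the nearly closest point `q k` of the first clopen ball `K k`
  -- containing it.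
  let p : X → F := fun x => if hx : x ∈ F then ⟨x, hx⟩ else
    ⟨q (Nat.find (hcov x hx)), hqF _⟩
  have hpF : ∀ x : F, p x = x := fun x => dif_pos x.2
  -- With `D = d(c k, F)`, the bound `d(x, c k) < D/2` gives `D < 2 d(x,F)`, and `d(q k, x) < 2D +
  -- D/2`.
  have hpd : ∀ x, dist (p x : X) x ≤ 5 * Metric.infDist x F := fun x => by
    by_cases hx : x ∈ F
    · rw [hpF ⟨x, hx⟩, dist_self, Metric.infDist_zero_of_mem hx, mul_zero]
    · have hpx : (p x : X) = q (Nat.find (hcov x hx)) := by simp only [p, dif_neg hx]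
      have h1 := hKd _ x (Nat.find_spec (hcov x hx))
      have h2 := hqd (Nat.find (hcov x hx))
      rw [hpx]
      set k := Nat.find (hcov x hx)
      have h3 := Metric.infDist_le_infDist_add_dist (s := F) (x := c k) (y := x)
      have h4 := dist_triangle (q k) (c k) x
      rw [dist_comm (c k) x] at h3 h4
      rw [dist_comm (q k) (c k)] at h4
      linarith
  refine ⟨p, continuous_iff_continuousAt.2 fun x => ?_, hpF⟩
  by_cases hx : x ∈ F
  · rw [Metric.continuousAt_iff]
    refine fun ε hε => ⟨ε / 6, by positivity, fun y hy => ?_⟩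
    have h1 := hpd y
    have h2 := Metric.infDist_le_dist_of_mem (x := y) hx
    have h3 := dist_triangle (p y : X) y x
    rw [Subtype.dist_eq, hpF ⟨x, hx⟩]
    change dist (p y : X) x < ε
    linarith
  -- Off `F` the first index is locally constant, hence so is `p`.
  · have hmem : {y | y ∈ K (Nat.find (hcov x hx)) ∧ ∀ m < Nat.find (hcov x hx), y ∉ K m} ∈ 𝓝 x :=
      (isOpen_find_eq hK _).mem_nhds
        ⟨Nat.find_spec (hcov x hx), fun m hm => Nat.find_min (hcov x hx) hm⟩
    refine (continuousAt_const (y := p x)).congr ?_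
    filter_upwards [hmem, hF.isOpen_compl.mem_nhds hx] with y hy hyF
    have hfind : Nat.find (hcov y hyF) = Nat.find (hcov x hx) :=
      (Nat.find_eq_iff _).2 ⟨hy.1, hy.2⟩
    simp only [p, dif_neg hx, dif_neg (show y ∉ F from hyF), hfind]

/-! ### Transfer of representations -/

theorem limitPart_limitPart_add_natCast (β : Ordinal.{u}) (n : ℕ) :
    limitPart (limitPart β + n) = limitPart β := by
  rw [limitPart, limitPart, Ordinal.mul_add_div _ Ordinal.omega0_ne_zero,
    Ordinal.div_eq_zero_of_lt (Ordinal.natCast_lt_omega0 n), add_zero]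

theorem finitePart_limitPart_add_natCast (β : Ordinal.{u}) (n : ℕ) :
    finitePart (limitPart β + n) = n := by
  rw [finitePart, limitPart, Ordinal.mul_add_mod_self,
    Ordinal.mod_eq_of_lt (Ordinal.natCast_lt_omega0 n)]
  simp

/-- Since `p` fixes `F`, each `p ⁻¹' B α` is `B α` together with countably many points off `F`, and
is empty only when `B α` is. -/
theorem IsDRepresentation.preimage_retraction {X : Type u} [TopologicalSpace X]
    [TopologicalSpace.MetrizableSpace X] {F : Set X} (hF : IsClosed F) (hc : Fᶜ.Countable)
    {p : X → F} (hp : Continuous p) (hpF : ∀ x : F, p x = x) {β : Ordinal.{u}}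
    {B : Ordinal.{u} → Set F} (hB : IsDRepresentation F β B) :
    IsDRepresentation X β fun α => p ⁻¹' B α := by
  have hind : ∀ α ≤ limitPart β, largeInd (p ⁻¹' B α) = largeInd (B α) := fun α hα => by
    let f : B α → p ⁻¹' B α := fun y => ⟨y.1.1, by rw [mem_preimage, hpF]; exact y.2⟩
    have hf : IsClosedEmbedding (Subtype.val ∘ f) :=
      hF.isClosedEmbedding_subtypeVal.comp (hB.isClosed α hα).isClosedEmbedding_subtypeVal
    refine largeInd_eq_of_countable_compl_range (hf.of_comp IsEmbedding.subtypeVal) ?_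
      fun h => ⟨fun x => h.false ⟨p x.1, x.2⟩⟩
    refine (hc.preimage Subtype.val_injective).mono fun x hx => ?_
    refine mem_preimage.2 fun hxF => hx ?_
    have hxB : (⟨x.1, hxF⟩ : F) ∈ B α := by
      have := x.2
      rwa [mem_preimage, hpF ⟨x.1, hxF⟩] at this
    exact ⟨⟨⟨x.1, hxF⟩, hxB⟩, rfl⟩
  constructor
  · rw [← preimage_iUnion₂, hB.iUnion_eq, preimage_univ]
  · exact fun α hα => (hB.isClosed α hα).preimage hp
  · exact fun α hα => (hind α hα).trans_lt (hB.finiteDimensional α hα)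
  · intro δ
    rw [← preimage_iUnion₂]
    exact (hB.isClosed_tail δ).preimage hp
  · rintro ⟨x, hx⟩
    rw [hind _ le_rfl]
    exact hB.finitePart_eq ⟨p x, hx⟩
  · refine fun h => hB.finitePart_eq_zero (eq_empty_of_forall_notMem fun y hy => ?_)
    exact h.le (show (y : X) ∈ p ⁻¹' B _ by rwa [mem_preimage, hpF])
  · exact fun x => hB.exists_greatest (p x)

/-- The limit part of `β` is kept. The finite part becomes `Ind` of the last trace, or `0` if that
trace is empty, and monotonicity of `Ind` on closed subsets bounds it. -/
theorem IsDRepresentation.exists_le_restrict {X : Type u} [TopologicalSpace X] {F : Set X}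
    (hF : IsClosed F) {β : Ordinal.{u}} {A : Ordinal.{u} → Set X}
    (hA : IsDRepresentation X β A) :
    ∃ γ ≤ β, ∃ B, IsDRepresentation F γ B := by
  let B : Ordinal.{u} → Set F := fun α => Subtype.val ⁻¹' A α
  have hemb : ∀ α ≤ limitPart β, IsClosedEmbedding fun y : B α => (⟨y.1.1, y.2⟩ : A α) :=
    fun α hα => by
      have hf : IsClosedEmbedding (Subtype.val ∘ fun y : B α => (⟨y.1.1, y.2⟩ : A α)) :=
        hF.isClosedEmbedding_subtypeVal.comp
          ((hA.isClosed α hα).preimage continuous_subtype_val).isClosedEmbedding_subtypeVal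
      exact hf.of_comp IsEmbedding.subtypeVal
  have hle : ∀ α ≤ limitPart β, largeInd (B α) ≤ largeInd (A α) := fun α hα =>
    largeInd_le_of_isClosedEmbedding (hemb α hα) (hA.finiteDimensional α hα)
  have hfin : ∀ α ≤ limitPart β, largeInd (B α) < ⊤ := fun α hα =>
    (hle α hα).trans_lt (hA.finiteDimensional α hα)
  obtain ⟨n, hnβ, hn, hn0⟩ : ∃ n ≤ finitePart β,
      ((B (limitPart β)).Nonempty →
        largeInd (B (limitPart β)) = ((n : ℕ∞) : WithBot ℕ∞)) ∧
      (B (limitPart β) = ∅ → n = 0) := by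
    rcases (B (limitPart β)).eq_empty_or_nonempty with h | h
    · exact ⟨0, Nat.zero_le _, fun h' => absurd h h'.ne_empty, fun _ => rfl⟩
    · have := h.to_subtype
      obtain ⟨n, hn⟩ := exists_largeInd_eq_natCast (hfin _ le_rfl)
      refine ⟨n, ?_, fun _ => hn, fun h' => absurd h' h.ne_empty⟩
      have hAne : (A (limitPart β)).Nonempty := h.elim fun y hy => ⟨y, hy⟩
      have := hle _ le_rfl
      rw [hn, hA.finitePart_eq hAne, WithBot.coe_le_coe, Nat.cast_le] at this
      exact this
  refine ⟨limitPart β + n, ?_, B, ?_⟩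
  · conv_rhs => rw [← limitPart_add_finitePart β]
    gcongr
  constructor
  all_goals simp only [limitPart_limitPart_add_natCast, finitePart_limitPart_add_natCast]
  · rw [← preimage_iUnion₂, hA.iUnion_eq, preimage_univ]
  · exact fun α hα => (hA.isClosed α hα).preimage continuous_subtype_val
  · exact hfin
  · intro δ
    rw [← preimage_iUnion₂]
    exact (hA.isClosed_tail δ).preimage continuous_subtype_val
  · rw [limitPart_limitPart_add_natCast]
    exact hn
  · exact hn0
  · exact fun x => hA.exists_greatest x

end DDim

theorem mainTheorem8 {X : Type u} [TopologicalSpace X] [TopologicalSpace.MetrizableSpace X]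
    (Xs X0 : Set X) (hX : Xs ∪ X0 = Set.univ) (hne : Xs.Nonempty) (hclosed : IsClosed Xs)
    (hcount : X0.Countable) :
    DDim.dDim X = DDim.dDim Xs := by
  have hc : Xsᶜ.Countable := hcount.mono fun x hx => (hX.ge (mem_univ x)).resolve_left hx
  obtain ⟨p, hp, hpX⟩ := DDim.exists_retraction_of_countable_compl hclosed hne hc
  have hup : ∀ β, (∃ B, DDim.IsDRepresentation Xs β B) → ∃ A, DDim.IsDRepresentation X β A :=
    fun β ⟨_, hB⟩ => ⟨_, hB.preimage_retraction hclosed hc hp hpX⟩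
  have hdown : ∀ β, (∃ A, DDim.IsDRepresentation X β A) →
      ∃ γ ≤ β, ∃ B, DDim.IsDRepresentation Xs γ B :=
    fun β ⟨_, hA⟩ => hA.exists_le_restrict hclosed
  have hX' : ¬ IsEmpty X := fun h => h.false hne.some
  have hXs' : ¬ IsEmpty Xs := not_isEmpty_iff.2 hne.to_subtype
  rw [DDim.dDim, DDim.dDim, if_neg hX', if_neg hXs']
  by_cases h : ∃ β, ∃ A, DDim.IsDRepresentation X β A
  · obtain ⟨β, hβ⟩ := h
    obtain ⟨γ, -, hγ⟩ := hdown β hβ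
    rw [if_pos ⟨β, hβ⟩, if_pos ⟨γ, hγ⟩]
    congr 1
    refine congrArg WithTop.some (?_ : sInf {β : Ordinal.{u} | ∃ A, DDim.IsDRepresentation X β A} =
      sInf {β : Ordinal.{u} | ∃ A, DDim.IsDRepresentation Xs β A})
    refine le_antisymm (le_csInf ⟨γ, hγ⟩ fun δ hδ => csInf_le' (hup δ hδ)) (le_csInf ⟨β, hβ⟩ fun δ hδ => ?_)
    obtain ⟨ε, hε, hεB⟩ := hdown δ hδ
    exact (csInf_le' (show ε ∈ {β | ∃ B, DDim.IsDRepresentation Xs β B} from hεB)).trans hε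
  · rw [if_neg h, if_neg fun ⟨β, hβ⟩ => h ⟨β, hup β hβ⟩]
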